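/- All rings are commutative with $1$. Let $K$ be a ring, $R$ a faithful $K$-algebra, and $G$ a finite groupoid with set of identities $G_0$; write $d(g)=g^{-1}g$ and $r(g)=gg^{-1}$, so that $gh$ is defined iff $d(g)=r(h)$. Let $\beta$ be an action of $G$ on $R$ by unital ideals: a family of ideals $E_g=E_{r(g)}$ of $R$ ($g\in G$), each with an identity element $1_g$, and $K$-algebra isomorphisms $\beta_g:E_{g^{-1}}\to E_g$ such that $\beta_e=\mathrm{id}_{E_e}$ for $e\in G_0$ and $\beta_g\circ\beta_h=\beta_{gh}$ whenever $gh$ is defined. Assume $R=\bigoplus_{e\in G_0}E_e$. For a subgroupoid $H$ of $G$ put $$R^{\beta_H}=\{r\in R \mid \beta_h(rx)=r\beta_h(x)\ \text{for all } h\in H,\ x\in E_{h^{-1}}\},\qquad R^\beta=R^{\beta_G}.$$ Assume that $R$ is a $\beta$-Galois extension of $K$, that is, $R^\beta=K$ and there are finitely many $x_i,y_i\in R$ such that $\sum_i x_i\beta_g(y_i1_{g^{-1}})$ equals $1_g$ if $g\in G_0$ and $0$ if $g\notin G_0$. Let $T$ be a $K$-subalgebra of $R$, and let $H_T=\{g\in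 G\mid \beta_g(t1_{g^{-1}})=t1_g \text{ for all } t\in T\}$, a subgroupoid of $G$ containing $G_0$. Call $T$ *separable* over $K$ if $T$ is a projective $T\otimes_K T$-module (via multiplication), and *$\beta$-strong* if for all $g,h\in G$ with $r(g)=r(h)$ and $g^{-1}h\notin H_T$, and every nonzero idempotent $\pi\in E_g=E_h$, there is $t\in T$ with $\beta_g(t1_{g^{-1}})\pi\neq\beta_h(t1_{h^{-1}})\pi$. **Lemma 5.4.** The following conditions are equivalent: 1. $T$ is separable over $K$ and $\beta$-strong; 2. $T=R^{\beta_{H_T}}$. In this case $T$ is *$R$-split*, in the following sense: there are integers $n_e\ge 1$ and isomorphisms of $E_e$-algebras $\varphi_e:E_e\otimes_K T\to (E_e)^{n_e}$ ($e\in G_0$) such that the sets $V_e(T)=\{\,t\mapsto \varphi_e(1_e\otimes t)_i \mid 1\le i\le n_e\,\}$ of $K$-algebra homomorphisms $T\to E_e$ form a $G$-set under $f\mapsto\beta_g\circ f$, i.e. $f\mapsto\beta_g\circ f$ is a bijection $V_{d(g)}(T)\to V_{r(g)}(T)$ for every $g\in G$. If moreover every $E_e$ is faithful as a $K$-module, then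 this can be done with one and the same integer $n_e=m\ge 1$ for all $e\in G_0$. -/

import Mathlib

open CategoryTheory
open scoped TensorProduct

/-- A commutative `K`-algebra `A` is *separable* if `A` is projective as a module over `A ⊗[K] A`,
which acts on `A` through the multiplication map `a ⊗ b ↦ a * b`. -/
def IsSeparableAlgebra (K A : Type*) [CommRing K] [CommRing A] [Algebra K A] : Prop :=
  letI : Module (A ⊗[K] A) A :=
    (Algebra.TensorProduct.lmul' K (S := A)).toRingHom.toModule
  Module.Projective (A ⊗[K] A) A

/-- An action `β` of a groupoid on a commutative `K`-algebra `R` by unital ideals.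
The groupoid is presented as a category: its identities are the objects, `d(g)` and `r(g)` are the
source and the target of the arrow `g`, and the product `g h`, defined iff `d(g) = r(h)`,
is `h ≫ g`. For `g : a ⟶ b` one has `E_g = E_{r(g)} = E b` and `E_{g⁻¹} = E_{d(g)} = E a`. -/
structure GroupoidAction (G K R : Type*) [Groupoid G] [CommRing K] [CommRing R] [Algebra K R] where
  /-- the ideals `E_e` -/
  E : G → Ideal R
  /-- the identity element `1_e` of the ideal `E_e` -/
  one : G → R
  one_mem : ∀ a, one a ∈ E a
  one_mul : ∀ a, ∀ x ∈ E a, one a * x = x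
  /-- the isomorphisms `β_g : E_{g⁻¹} → E_g`: they are `K`-linear, bijective and, by `map_mul`,
  multiplicative -/
  map : ∀ {a b : G}, (a ⟶ b) → (E a ≃ₗ[K] E b)
  map_mul : ∀ {a b : G} (g : a ⟶ b) (x y : E a),
    map g ((x : R) • y) = (map g x : R) • map g y
  map_id : ∀ (a : G) (x : E a), map (𝟙 a) x = x
  map_comp : ∀ {a b c : G} (g : a ⟶ b) (h : b ⟶ c) (x : E a), map (g ≫ h) x = map h (map g x)

namespace GroupoidAction

variable {G K R : Type*} [Groupoid G] [CommRing K] [CommRing R] [Algebra K R]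
variable (β : GroupoidAction G K R)

/-- The ideal `E_e`, regarded as a ring with identity element `1_e`. -/
def Piece (a : G) : Type _ := β.E a

instance (a : G) : AddCommGroup (β.Piece a) := inferInstanceAs (AddCommGroup (β.E a))

instance (a : G) : Module K (β.Piece a) := inferInstanceAs (Module K (β.E a))

/-- The inclusion `E_e ⊆ R`. -/
def val {a : G} (x : β.Piece a) : R := Subtype.val (p := (· ∈ β.E a)) x

theorem val_injective (a : G) : Function.Injective (β.val (a := a)) := Subtype.val_injective

instance (a : G) : Mul (β.Piece a) :=
  ⟨fun x y => (⟨β.val x * β.val y, (β.E a).mul_mem_left _ (Subtype.prop (p := (· ∈ β.E a)) y)⟩ :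
    β.E a)⟩

instance (a : G) : One (β.Piece a) := ⟨(⟨β.one a, β.one_mem a⟩ : β.E a)⟩

theorem val_mul {a : G} (x y : β.Piece a) : β.val (x * y) = β.val x * β.val y := rfl

theorem val_add {a : G} (x y : β.Piece a) : β.val (x + y) = β.val x + β.val y := rfl

theorem val_zero {a : G} : β.val (0 : β.Piece a) = 0 := rfl

theorem val_one {a : G} : β.val (1 : β.Piece a) = β.one a := rfl

theorem val_smul {a : G} (k : K) (x : β.Piece a) : β.val (k • x) = k • β.val x := rfl

theorem one_mul_val {a : G} (x : β.Piece a) : β.one a * β.val x = β.val x :=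
  β.one_mul a _ (Subtype.prop (p := (· ∈ β.E a)) x)

instance (a : G) : CommRing (β.Piece a) :=
  { (inferInstance : AddCommGroup (β.Piece a)) with
    mul := (· * ·)
    one := 1
    left_distrib := fun x y z => β.val_injective a (by
      simp only [val_mul, val_add, mul_add])
    right_distrib := fun x y z => β.val_injective a (by
      simp only [val_mul, val_add, add_mul])
    zero_mul := fun x => β.val_injective a (by simp only [val_mul, val_zero, zero_mul])
    mul_zero := fun x => β.val_injective a (by simp only [val_mul, val_zero, mul_zero])
    mul_assoc := fun x y z => β.val_injective a (by simp only [val_mul, mul_assoc])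
    one_mul := fun x => β.val_injective a (by
      simp only [val_mul, val_one, one_mul_val])
    mul_one := fun x => β.val_injective a (by
      rw [val_mul, val_one, mul_comm, one_mul_val])
    mul_comm := fun x y => β.val_injective a (by simp only [val_mul, mul_comm]) }

instance (a : G) : Algebra K (β.Piece a) :=
  Algebra.ofModule
    (fun k x y => β.val_injective a (by simp only [val_mul, val_smul, smul_mul_assoc]))
    (fun k x y => β.val_injective a (by simp only [val_mul, val_smul, mul_smul_comm]))

/-- The element `r 1_e` of `E_e`. -/
def cut (a : G) (r : R) : β.E a := ⟨r * β.one a, (β.E a).mul_mem_left r (β.one_mem a)⟩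

theorem cut_coe {a : G} (x : β.E a) : β.cut a x = x :=
  Subtype.ext ((mul_comm _ _).trans (β.one_mul a _ x.2))

theorem cut_mul (a : G) (r s : R) : β.cut a (r * s) = (β.cut a r : R) • β.cut a s := by
  refine Subtype.ext ?_
  have := β.one_mul a _ (β.one_mem a)
  change r * s * β.one a = r * β.one a * (s * β.one a)
  linear_combination (-(r * s)) * this

theorem cut_mul_one (a : G) (r : R) : β.cut a (r * β.one a) = β.cut a r := by
  refine Subtype.ext ?_
  have := β.one_mul a _ (β.one_mem a)
  change r * β.one a * β.one a = r * β.one a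
  linear_combination r * this

/-- The map `r ↦ β_g(r 1_{g⁻¹})` from `R` to `R`. -/
def app {a b : G} (g : a ⟶ b) (r : R) : R := β.map g (β.cut a r)

theorem app_coe {a b : G} (g : a ⟶ b) (x : β.E a) : β.app g x = β.map g x := by
  unfold app
  rw [cut_coe]

theorem app_mul {a b : G} (g : a ⟶ b) (r s : R) : β.app g (r * s) = β.app g r * β.app g s := by
  unfold app
  rw [cut_mul, β.map_mul]
  rfl

theorem app_id (a : G) (r : R) : β.app (𝟙 a) r = r * β.one a := by
  unfold app
  rw [β.map_id]
  rfl

theorem app_mul_one {a b : G} (g : a ⟶ b) (r : R) : β.app g (r * β.one a) = β.app g r := by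
  unfold app
  rw [cut_mul_one]

theorem app_comp {a b c : G} (g : a ⟶ b) (h : b ⟶ c) (r : R) :
    β.app (g ≫ h) r = β.app h (β.app g r) := by
  conv_rhs => rw [app, app, cut_coe]
  rw [app, β.map_comp]

theorem app_one {a b : G} (g : a ⟶ b) : β.app g (β.one a) = β.one b := by
  have h : ∀ y : β.E b, β.app g (β.one a) * (y : R) = y := by
    intro y
    obtain ⟨x, rfl⟩ := (β.map g).surjective y
    rw [← app_coe, ← app_mul, β.one_mul a _ x.2]
  have h1 : β.app g (β.one a) * β.one b = β.one b := h ⟨β.one b, β.one_mem b⟩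
  have h2 : β.one b * β.app g (β.one a) = β.app g (β.one a) :=
    β.one_mul b _ (β.map g _).2
  rw [← h2, mul_comm, h1]

/-- `β_g : E_{g⁻¹} → E_g`, between the rings `E_{g⁻¹}` and `E_g`. -/
def act {a b : G} (g : a ⟶ b) (x : β.Piece a) : β.Piece b := β.map g x

theorem val_act {a b : G} (g : a ⟶ b) (x : β.Piece a) : β.val (β.act g x) = β.app g (β.val x) :=
  (β.app_coe g x).symm

/-- For a subgroupoid `H`, the subalgebra `R^{β_H}` of the invariants of `R` under the restriction
`β_H` of the action to `H`: all `r` with `β_h(r x) = r β_h(x)` for all `h ∈ H` and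
`x ∈ E_{h⁻¹}`. For `H = ⊤` it is `R^β`. -/
def invariants (H : Subgroupoid G) : Subalgebra K R where
  carrier := {r | ∀ a b : G, ∀ h ∈ H.arrows a b, ∀ x : β.E a, β.map h (r • x) = r • β.map h x}
  mul_mem' := fun {r s} hr hs a b h hh x => by
    rw [mul_smul, hr a b h hh, hs a b h hh, mul_smul]
  add_mem' := fun {r s} hr hs a b h hh x => by
    rw [add_smul, map_add, hr a b h hh, hs a b h hh, add_smul]
  algebraMap_mem' := fun k a b h _ x => by
    rw [algebraMap_smul, map_smul, algebraMap_smul]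

/-- `R = ⨁_{e ∈ G₀} E_e`, an internal direct sum. -/
def IsDirectSum : Prop := iSupIndep β.E ∧ ⨆ a, β.E a = ⊤

/-- `R` is a `β`-Galois extension of `K`: `R^β` is the image of `K` in `R`, and there are
finitely many `x_i, y_i ∈ R` such that `∑ x_i β_g(y_i 1_{g⁻¹})` equals `1_e` if `g` is
the identity arrow of an object `e`, and `0` if `g` is not an identity arrow. -/
structure IsGaloisExtension : Prop where
  invariants_eq : β.invariants ⊤ = ⊥
  exists_coordinates : ∃ (n : ℕ) (x y : Fin n → R),
    (∀ a : G, ∑ i, x i * β.app (𝟙 a) (y i) = β.one a) ∧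
    (∀ (a : G) (g : a ⟶ a), g ≠ 𝟙 a → ∑ i, x i * β.app g (y i) = 0) ∧
    (∀ (a b : G) (g : a ⟶ b), a ≠ b → ∑ i, x i * β.app g (y i) = 0)

/-- The subgroupoid `H_T` of all `g` with `β_g(t 1_{g⁻¹}) = t 1_g` for all `t ∈ T`. -/
def fixing (T : Subalgebra K R) : Subgroupoid G where
  arrows := fun a b => {g | ∀ t ∈ T, β.app g t = t * β.one b}
  inv := fun {a b g} hg t ht => by
    rw [← β.app_mul_one, ← hg t ht, ← β.app_comp, Groupoid.comp_inv, β.app_id]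
  mul := fun {a b c g} hg {h} hh t ht => by
    rw [β.app_comp, hg t ht, β.app_mul_one, hh t ht]

theorem fixing_isWide (T : Subalgebra K R) : (β.fixing T).IsWide :=
  ⟨fun a t _ => β.app_id a t⟩

/-- `T` is `β`-strong: for all `g, h` with `r(g) = r(h)` and `g⁻¹ h ∉ H_T` and every nonzero
idempotent `π ∈ E_g = E_h` there is `t ∈ T` with `β_g(t 1_{g⁻¹}) π ≠ β_h(t 1_{h⁻¹}) π`. -/
def IsStrong (T : Subalgebra K R) : Prop :=
  ∀ (a b c : G) (g : a ⟶ c) (h : b ⟶ c), h ≫ Groupoid.inv g ∉ (β.fixing T).arrows b a →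
    ∀ π ∈ β.E c, IsIdempotentElem π → π ≠ 0 → ∃ t ∈ T, β.app g t * π ≠ β.app h t * π

/-- For an isomorphism `φ : E_e ⊗ B → (E_e)^n` of `E_e`-algebras, the set `V_e(B)` of the
homomorphisms `b ↦ φ(1 ⊗ b)_i` of `K`-algebras from `B` to `E_e`, `1 ≤ i ≤ n`. -/
def components {B : Type*} [CommRing B] [Algebra K B] {a : G} {n : ℕ}
    (φ : (β.Piece a ⊗[K] B) ≃ₐ[β.Piece a] (Fin n → β.Piece a)) : Set (B →ₐ[K] β.Piece a) :=
  {f | ∃ i : Fin n, ∀ b : B, f b = φ (1 ⊗ₜ b) i}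

/-- The map `f ↦ β_g ∘ f` from `Alg_K(B, E_{g⁻¹})` to `Alg_K(B, E_g)`. -/
def push {B : Type*} [CommRing B] [Algebra K B] {a b : G} (g : a ⟶ b)
    (f : B →ₐ[K] β.Piece a) : B →ₐ[K] β.Piece b :=
  AlgHom.ofLinearMap ((β.map g).toLinearMap ∘ₗ f.toLinearMap)
    (β.val_injective b (by
      change β.val (β.act g (f 1)) = _
      rw [_root_.map_one, val_act, val_one, val_one, app_one]))
    (fun x y => β.val_injective b (by
      change β.val (β.act g (f (x * y))) = β.val (β.act g (f x)) * β.val (β.act g (f y))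
      rw [_root_.map_mul, val_act, val_act, val_act, val_mul, app_mul]))

theorem push_apply {B : Type*} [CommRing B] [Algebra K B] {a b : G} (g : a ⟶ b)
    (f : B →ₐ[K] β.Piece a) (x : B) : β.push g f x = β.act g (f x) := rfl

/-- The `K`-algebra `B` is `R`-split with ranks `n_e`: there are isomorphisms of `E_e`-algebras
`φ_e : E_e ⊗ B → (E_e)^{n_e}`, `n_e ≥ 1`, such that the sets `V_e(B)` of their components form
a `G`-set under `f ↦ β_g ∘ f`, that is, this map is a bijection `V_{g⁻¹}(B) → V_g(B)` for every
`g` (the identity and composition laws of a `G`-set are automatic, and so is the disjointness of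
the `V_e(B)`, whose elements have different codomains). -/
def IsSplitWith (B : Type*) [CommRing B] [Algebra K B] (n : G → ℕ) : Prop :=
  (∀ a, 1 ≤ n a) ∧
  ∃ φ : ∀ a : G, (β.Piece a ⊗[K] B) ≃ₐ[β.Piece a] (Fin (n a) → β.Piece a),
    ∀ (a b : G) (g : a ⟶ b), Set.BijOn (β.push g) (β.components (φ a)) (β.components (φ b))

/-- `R`-split, the ranks `n_e` being allowed to vary with the object `e`. -/
def IsSplit (B : Type*) [CommRing B] [Algebra K B] : Prop := ∃ n : G → ℕ, β.IsSplitWith B n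

/-- `R`-split with one and the same rank `m` at all objects. -/
def IsUniformlySplit (B : Type*) [CommRing B] [Algebra K B] : Prop :=
  ∃ m : ℕ, 1 ≤ m ∧ β.IsSplitWith B (fun _ => m)

end GroupoidAction

-- Everything passes through coordinate systems: finite families `u i`, `v i` in `S` with `∑ u i *
-- β_g(v i)` equal to `1_g` for `g ∈ H_S` and to `0` otherwise.
--
-- They exist under either condition. If `S = R^{β_H}`, averaging Galois coordinates over `H` gives
-- `u i = tr_H(c x i)`, `v i = tr_H(y i)` with `tr_H(c) = 1` (`exists_invariant_coordinates`). If
-- `S` is separable and strong, they are the two legs of a separability idempotent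
-- (`exists_isCoordinateSystem_of_isSeparableAlgebra`).
--
-- Conversely, let `V_e` be the set of distinct maps `s ↦ β_g(s 1_{g⁻¹})` with `r(g) = e`.
-- Coordinates make it orthonormal: `∑ f(u i) f'(v i) = δ_{f,f'}`. Summing all of the `V_e` gives a
-- trace `τ : S → K` with `s = ∑ τ(s v i) u i` (`sum_trace_smul`). This dual basis formula yields
-- the separability idempotent `∑ u i ⊗ v i`, the equality `S = R^{β_{H_S}}` and the injectivity of
-- `E_e ⊗ S → ∏_{V_e} E_e`; orthonormality yields surjectivity and strongness.

universe w

namespace GroupoidAction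

variable {G K R : Type*} [Groupoid G] [CommRing K] [CommRing R] [Algebra K R]
variable (β : GroupoidAction G K R)

/-! ### Calculus of the maps `app`, invariants and fixing subgroupoids. -/

theorem one_mul_one (a : G) : β.one a * β.one a = β.one a := β.one_mul a _ (β.one_mem a)

theorem app_mem {a b : G} (g : a ⟶ b) (r : R) : β.app g r ∈ β.E b := (β.map g _).2

theorem one_mul_app {a b : G} (g : a ⟶ b) (r : R) : β.one b * β.app g r = β.app g r :=
  β.one_mul b _ (β.app_mem g r)

theorem app_mul_one_target {a b : G} (g : a ⟶ b) (r : R) :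
    β.app g r * β.one b = β.app g r := by
  rw [mul_comm, one_mul_app]

theorem cut_add (a : G) (r s : R) : β.cut a (r + s) = β.cut a r + β.cut a s :=
  Subtype.ext (add_mul _ _ _)

theorem cut_smul (a : G) (k : K) (r : R) : β.cut a (k • r) = k • β.cut a r :=
  Subtype.ext (smul_mul_assoc _ _ _)

/-- The map `r ↦ β_g(r 1_{g⁻¹})` as a `K`-linear map. -/
def appLinear {a b : G} (g : a ⟶ b) : R →ₗ[K] R where
  toFun := β.app g
  map_add' r s := by simp only [app, cut_add, map_add]; rfl
  map_smul' k r := by simp only [app, cut_smul, map_smul]; rfl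

theorem app_add {a b : G} (g : a ⟶ b) (r s : R) : β.app g (r + s) = β.app g r + β.app g s :=
  (β.appLinear g).map_add r s

theorem app_zero {a b : G} (g : a ⟶ b) : β.app g 0 = 0 := (β.appLinear g).map_zero

theorem app_sum {a b : G} (g : a ⟶ b) {ι : Type*} (s : Finset ι) (r : ι → R) :
    β.app g (∑ i ∈ s, r i) = ∑ i ∈ s, β.app g (r i) :=
  map_sum (β.appLinear g) r s

theorem app_unit {a b : G} (g : a ⟶ b) : β.app g 1 = β.one b := by
  rw [← app_one β g, ← β.app_mul_one g 1, _root_.one_mul]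

theorem app_inv_app {a b : G} (g : a ⟶ b) (r : R) :
    β.app (Groupoid.inv g) (β.app g r) = r * β.one a := by
  rw [← app_comp, Groupoid.comp_inv, app_id]

theorem app_app_inv {a b : G} (g : a ⟶ b) (r : R) :
    β.app g (β.app (Groupoid.inv g) r) = r * β.one b := by
  rw [← app_comp, Groupoid.inv_comp, app_id]

theorem mem_invariants_iff {H : Subgroupoid G} {r : R} :
    r ∈ β.invariants H ↔ ∀ (a b : G), ∀ h ∈ H.arrows a b, β.app h r = r * β.one b := by
  constructor
  · intro hr a b h hh
    have := congrArg (Subtype.val) (hr a b h hh ⟨β.one a, β.one_mem a⟩)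
    have h1 : (β.map h ⟨β.one a, β.one_mem a⟩ : R) = β.one b := by
      rw [← app_coe, app_one]
    change (β.map h (β.cut a r) : R) = r * (β.map h ⟨β.one a, β.one_mem a⟩ : R) at this
    rw [h1] at this
    exact this
  · intro hr a b h hh x
    refine Subtype.ext ?_
    rw [← app_coe]
    change β.app h (r * (x : R)) = r * (β.map h x : R)
    rw [app_mul, hr a b h hh, app_coe, mul_assoc, β.one_mul b _ (β.map h x).2]

theorem mem_fixing_iff {T : Subalgebra K R} {a b : G} {g : a ⟶ b} :
    g ∈ (β.fixing T).arrows a b ↔ ∀ t ∈ T, β.app g t = t * β.one b := Iff.rfl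

theorem le_invariants_fixing (T : Subalgebra K R) : T ≤ β.invariants (β.fixing T) :=
  fun t ht => β.mem_invariants_iff.2 fun _ _ _ hh => hh t ht

/-- The closure property of a Galois connection; it makes coordinates for `S` serve also for
`R^{β_{H_S}}`. -/
theorem fixing_invariants_fixing (T : Subalgebra K R) :
    β.fixing (β.invariants (β.fixing T)) = β.fixing T := by
  ext a b g
  refine ⟨fun hg t ht => hg t (β.le_invariants_fixing T ht), fun hg t ht => ?_⟩
  exact β.mem_invariants_iff.1 ht a b g hg

/-- Here `h ≫ inv g` is `g⁻¹h`: arrows induce the same map on `T` exactly when they lie in one left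
coset of `H_T`. -/
theorem comp_inv_mem_fixing_iff {T : Subalgebra K R} {a b c : G} {g : a ⟶ c} {h : b ⟶ c} :
    h ≫ Groupoid.inv g ∈ (β.fixing T).arrows b a ↔ ∀ t ∈ T, β.app h t = β.app g t := by
  rw [mem_fixing_iff]
  refine forall₂_congr fun t _ => ?_
  rw [app_comp]
  constructor
  · intro e
    have := congrArg (β.app g) e
    rwa [app_app_inv, app_mul_one_target, app_mul_one] at this
  · intro e
    rw [e, app_inv_app]

section DirectSum

variable {β}

theorem IsDirectSum.one_mul_one_of_ne (hsum : β.IsDirectSum) {a b : G} (hab : a ≠ b) :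
    β.one a * β.one b = 0 := by
  have h := hsum.1.pairwiseDisjoint hab
  exact (Submodule.disjoint_def.1 h) _ ((β.E a).mul_mem_right _ (β.one_mem a))
    ((β.E b).mul_mem_left _ (β.one_mem b))

theorem IsDirectSum.sum_one [Fintype G] (hsum : β.IsDirectSum) : ∑ a, β.one a = 1 := by
  classical
  have key : ∀ r : R, r ∈ ⨆ a, β.E a → r * ∑ a, β.one a = r := by
    intro r hr
    induction hr using Submodule.iSup_induction' with
    | mem a x hx =>
      rw [Finset.mul_sum, Finset.sum_eq_single a]
      · rw [mul_comm, β.one_mul a x hx]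
      · intro b _ hb
        rw [← β.one_mul a x hx, mul_right_comm, hsum.one_mul_one_of_ne hb.symm, zero_mul]
      · simp
    | zero => simp
    | add x y _ _ hx hy => rw [add_mul, hx, hy]
  simpa using key 1 (hsum.2 ▸ Submodule.mem_top)

theorem IsDirectSum.app_eq_zero (hsum : β.IsDirectSum) {a b c : G} (g : a ⟶ b) {r : R}
    (hr : r ∈ β.E c) (h : c ≠ a) : β.app g r = 0 := by
  rw [← β.app_mul_one, ← β.one_mul c r hr, mul_right_comm, hsum.one_mul_one_of_ne h, zero_mul,
    app_zero]

theorem IsDirectSum.mul_eq_zero (hsum : β.IsDirectSum) {a b : G} (hab : a ≠ b) {r s : R}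
    (hr : r ∈ β.E a) (hs : s ∈ β.E b) : r * s = 0 := by
  rw [← β.one_mul a r hr, ← β.one_mul b s hs, mul_mul_mul_comm, hsum.one_mul_one_of_ne hab,
    zero_mul]

end DirectSum

/-! ### Coordinate systems of a subalgebra. -/

open scoped Classical in
/-- Finite families `u`, `v` in a subalgebra `S` with `∑ u_i β_g(v_i 1_{g⁻¹}) = 1_g` if `g ∈ H_S`
and `0` otherwise. -/
def IsCoordinateSystem (S : Subalgebra K R) {ι : Type*} [Fintype ι] (u v : ι → S) : Prop :=
  ∀ (a b : G) (g : a ⟶ b), ∑ i, (u i : R) * β.app g (v i) =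
    if g ∈ (β.fixing S).arrows a b then β.one b else 0

section Coordinates

variable {β} {S : Subalgebra K R} {ι : Type*} [Fintype ι] {u v : ι → S}

/-- Apply `β_g` to the relation at `g⁻¹`. -/
theorem IsCoordinateSystem.symm (h : β.IsCoordinateSystem S u v) :
    β.IsCoordinateSystem S v u := by
  intro a b g
  have h1 := congrArg (β.app g) (h b a (Groupoid.inv g))
  have hiff : Groupoid.inv g ∈ (β.fixing S).arrows b a ↔ g ∈ (β.fixing S).arrows a b :=
    ⟨fun hg => by simpa using (β.fixing S).inv hg, fun hg => (β.fixing S).inv hg⟩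
  rw [app_sum] at h1
  calc ∑ i, (v i : R) * β.app g (u i)
      = ∑ i, β.app g ((u i : R) * β.app (Groupoid.inv g) (v i)) := by
        refine Finset.sum_congr rfl fun i _ => ?_
        rw [app_mul, app_app_inv, mul_left_comm, app_mul_one_target]
    _ = _ := by
        rw [h1]
        by_cases hg : g ∈ (β.fixing S).arrows a b
        · rw [if_pos hg, if_pos (hiff.2 hg), app_one]
        · rw [if_neg hg, if_neg (mt hiff.1 hg), app_zero]

-- Apply `β_g` to the relation at `g⁻¹k`.
open scoped Classical in
theorem IsCoordinateSystem.sum_app_mul_app (h : β.IsCoordinateSystem S u v) {a b c : G}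
    (g : a ⟶ c) (k : b ⟶ c) : ∑ i, β.app g (u i) * β.app k (v i) =
      if k ≫ Groupoid.inv g ∈ (β.fixing S).arrows b a then β.one c else 0 := by
  have h1 := congrArg (β.app g) (h b a (k ≫ Groupoid.inv g))
  rw [app_sum] at h1
  calc ∑ i, β.app g (u i) * β.app k (v i)
      = ∑ i, β.app g ((u i : R) * β.app (k ≫ Groupoid.inv g) (v i)) := by
        refine Finset.sum_congr rfl fun i _ => ?_
        rw [app_mul, app_comp, app_app_inv, app_mul_one_target]
    _ = _ := by
        rw [h1]
        split_ifs
        · rw [app_one]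
        · rw [app_zero]

theorem IsCoordinateSystem.sum_mul [Finite G] (hsum : β.IsDirectSum)
    (h : β.IsCoordinateSystem S u v) : ∑ i, u i * v i = 1 := by
  have := Fintype.ofFinite G
  refine Subtype.ext ?_
  rw [AddSubmonoidClass.coe_finsetSum]
  calc ∑ i, (u i : R) * v i = (∑ i, (u i : R) * v i) * ∑ a, β.one a := by
        rw [hsum.sum_one, mul_one]
    _ = ∑ a, ∑ i, (u i : R) * β.app (𝟙 a) (v i) := by
        rw [Finset.mul_sum]
        refine Finset.sum_congr rfl fun a _ => ?_
        rw [Finset.sum_mul]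
        refine Finset.sum_congr rfl fun i _ => ?_
        rw [app_id, mul_assoc]
    _ = ∑ a, β.one a := by
        refine Finset.sum_congr rfl fun a _ => ?_
        rw [h, if_pos]
        exact fun t _ => β.app_id a t
    _ = 1 := hsum.sum_one

/-- If `β_g` and `β_k` agreed on `S` after multiplication by `π`, exchanging them in the coordinate
sum would turn `1_c π` into `0`. -/
theorem IsCoordinateSystem.isStrong (h : β.IsCoordinateSystem S u v) : β.IsStrong S := by
  classical
  intro a b c g k hgk π hπ _ hne
  by_contra! hcon
  refine hne ?_
  have h0 : ∑ i, β.app g (u i) * β.app k (v i) = 0 := by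
    rw [h.sum_app_mul_app, if_neg hgk]
  have h1 : ∑ i, β.app g (u i) * β.app g (v i) = β.one c := by
    rw [h.sum_app_mul_app, if_pos]
    exact β.comp_inv_mem_fixing_iff.2 fun _ _ => rfl
  calc π = (∑ i, β.app g (u i) * β.app g (v i)) * π := by rw [h1, β.one_mul c π hπ]
    _ = (∑ i, β.app g (u i) * β.app k (v i)) * π := by
        rw [Finset.sum_mul, Finset.sum_mul]
        refine Finset.sum_congr rfl fun i _ => ?_
        rw [mul_assoc, hcon _ (v i).2, mul_assoc]
    _ = 0 := by rw [h0, zero_mul]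

end Coordinates

/-! ### The homomorphisms from `S` to `E_e` and the trace from `S` to `K`. -/

section Components

variable (S : Subalgebra K R)

theorem val_mem {a : G} (x : β.Piece a) : β.val x ∈ β.E a :=
  Subtype.prop (p := (· ∈ β.E a)) x

theorem val_mul_one {a : G} (x : β.Piece a) : β.val x * β.one a = β.val x := by
  rw [mul_comm, one_mul_val]

/-- The inclusion `E_e ⊆ R` as a `K`-linear map. -/
def valLinear (a : G) : β.Piece a →ₗ[K] R where
  toFun := β.val
  map_add' _ _ := rfl
  map_smul' _ _ := rfl

theorem val_sum {a : G} {ι : Type*} (s : Finset ι) (f : ι → β.Piece a) :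
    β.val (∑ i ∈ s, f i) = ∑ i ∈ s, β.val (f i) := map_sum (β.valLinear a) f s

/-- The homomorphism `r ↦ r 1_e` from `S` to `E_e`. -/
def proj (a : G) : S →ₐ[K] β.Piece a :=
  AlgHom.ofLinearMap
    { toFun := fun s => (β.cut a (s : R) : β.E a)
      map_add' := fun _ _ => β.cut_add a _ _
      map_smul' := fun _ _ => β.cut_smul a _ _ }
    (β.val_injective a (_root_.one_mul _))
    (fun x y => β.val_injective a (congrArg Subtype.val (β.cut_mul a (x : R) (y : R))))

theorem val_proj (a : G) (s : S) : β.val (β.proj S a s) = s * β.one a := rfl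

/-- The set of the homomorphisms `s ↦ β_g(s 1_{g⁻¹})` from `S` to `E_e`, where `r(g) = e`. -/
def arrowHoms (b : G) : Set (S →ₐ[K] β.Piece b) :=
  {f | ∃ (a : G) (g : a ⟶ b), f = β.push g (β.proj S a)}

variable {S}

theorem val_push {B : Type*} [CommRing B] [Algebra K B] {a b : G} (g : a ⟶ b)
    (f : B →ₐ[K] β.Piece a) (x : B) : β.val (β.push g f x) = β.app g (β.val (f x)) := by
  rw [push_apply, val_act]

theorem val_push_proj {a b : G} (g : a ⟶ b) (s : S) :
    β.val (β.push g (β.proj S a) s) = β.app g s := by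
  rw [val_push, val_proj, app_mul_one]

theorem push_comp {B : Type*} [CommRing B] [Algebra K B] {a b c : G} (g : a ⟶ b) (h : b ⟶ c)
    (f : B →ₐ[K] β.Piece a) : β.push (g ≫ h) f = β.push h (β.push g f) :=
  AlgHom.ext fun x => β.val_injective c (by rw [val_push, val_push, val_push, app_comp])

theorem push_id {B : Type*} [CommRing B] [Algebra K B] {a : G} (f : B →ₐ[K] β.Piece a) :
    β.push (𝟙 a) f = f :=
  AlgHom.ext fun x => β.val_injective a (by rw [val_push, app_id, val_mul_one])

theorem push_injective {B : Type*} [CommRing B] [Algebra K B] {a b : G} (g : a ⟶ b) :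
    Function.Injective (β.push (B := B) g) := by
  intro f f' h
  have := congrArg (β.push (Groupoid.inv g)) h
  rwa [← push_comp, ← push_comp, Groupoid.comp_inv, push_id, push_id] at this

theorem push_bijOn_arrowHoms {a b : G} (g : a ⟶ b) :
    Set.BijOn (β.push g) (β.arrowHoms S a) (β.arrowHoms S b) := by
  refine ⟨?_, (β.push_injective g).injOn, ?_⟩
  · rintro _ ⟨c, k, rfl⟩
    exact ⟨c, k ≫ g, by rw [push_comp]⟩
  · rintro _ ⟨c, k, rfl⟩
    refine ⟨β.push (k ≫ Groupoid.inv g) (β.proj S c), ⟨c, _, rfl⟩, ?_⟩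
    rw [← push_comp, Category.assoc, Groupoid.inv_comp, Category.comp_id]

theorem proj_mem_arrowHoms (a : G) : β.proj S a ∈ β.arrowHoms S a :=
  ⟨a, 𝟙 a, by rw [push_id]⟩

instance finite_arrowHoms [Finite G] [∀ a b : G, Finite (a ⟶ b)] (b : G) :
    Finite (β.arrowHoms S b) := by
  have : β.arrowHoms S b ⊆ Set.range
      (fun p : Σ a : G, (a ⟶ b) => β.push p.2 (β.proj S p.1)) := by
    rintro _ ⟨a, g, rfl⟩
    exact ⟨⟨a, g⟩, rfl⟩
  exact (Set.finite_range _).subset this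

noncomputable instance [Finite G] [∀ a b : G, Finite (a ⟶ b)] (b : G) :
    Fintype (β.arrowHoms S b) := Fintype.ofFinite _

theorem push_proj_eq_iff {a b c : G} (g : a ⟶ c) (h : b ⟶ c) :
    β.push h (β.proj S b) = β.push g (β.proj S a) ↔
      h ≫ Groupoid.inv g ∈ (β.fixing S).arrows b a := by
  rw [comp_inv_mem_fixing_iff]
  constructor
  · intro e t ht
    have := congrArg (fun f => β.val (f ⟨t, ht⟩)) e
    simpa only [val_push_proj] using this
  · intro e
    refine AlgHom.ext fun s => β.val_injective c ?_
    rw [val_push_proj, val_push_proj, e s s.2]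

open scoped Classical in
theorem IsCoordinateSystem.sum_arrowHoms {β : GroupoidAction G K R} {ι : Type*} [Fintype ι]
    {u v : ι → S} (h : β.IsCoordinateSystem S u v) {a : G} (f f' : β.arrowHoms S a) :
    ∑ i, f.1 (u i) * f'.1 (v i) = if f' = f then 1 else 0 := by
  obtain ⟨b, g, hg⟩ := f.2
  obtain ⟨c, k, hk⟩ := f'.2
  have hiff : f' = f ↔ k ≫ Groupoid.inv g ∈ (β.fixing S).arrows c b := by
    rw [← push_proj_eq_iff, Subtype.ext_iff, hg, hk]
  refine β.val_injective a ?_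
  rw [val_sum]
  simp only [hg, hk, val_mul, val_push_proj]
  rw [h.sum_app_mul_app]
  by_cases hf : f' = f
  · rw [if_pos hf, if_pos (hiff.1 hf), val_one]
  · rw [if_neg hf, if_neg (mt hiff.2 hf), val_zero]

variable [Finite G] [∀ a b : G, Finite (a ⟶ b)] {β}

/-- The sum runs over distinct homomorphisms, not over arrows, so each coset of `H_S` counts once.
It is invariant because `β_g` carries `V_{d(g)}` bijectively onto `V_{r(g)}`, hence it lies in `R^β
= K`; faithfulness makes its lift to `K` linear. -/
theorem IsGaloisExtension.exists_trace [Fintype G] [FaithfulSMul K R] (hsum : β.IsDirectSum)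
    (hβ : β.IsGaloisExtension) : ∃ τ : S →ₗ[K] K, ∀ s : S,
      algebraMap K R (τ s) = ∑ a, ∑ f : β.arrowHoms S a, β.val (f.1 s) := by
  have hmem : ∀ s : S, ∃ k : K,
      algebraMap K R k = ∑ a, ∑ f : β.arrowHoms S a, β.val (f.1 s) := by
    intro s
    have : ∑ a, ∑ f : β.arrowHoms S a, β.val (f.1 s) ∈ β.invariants ⊤ := by
      classical
      refine β.mem_invariants_iff.2 fun a b g _ => ?_
      rw [app_sum, Finset.sum_mul, Finset.sum_eq_single a, Finset.sum_eq_single b, app_sum,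
        Finset.sum_mul]
      · refine Fintype.sum_equiv ((β.push_bijOn_arrowHoms g).equiv) _ _ fun f => ?_
        change _ = β.val (β.push g f.1 s) * β.one b
        rw [val_mul_one, val_push]
      · intro c _ hc
        rw [Finset.sum_mul]
        exact Finset.sum_eq_zero fun f _ => hsum.mul_eq_zero hc (β.val_mem _) (β.one_mem b)
      · simp
      · intro c _ hc
        rw [app_sum]
        exact Finset.sum_eq_zero fun f _ => hsum.app_eq_zero g (β.val_mem _) hc
      · simp
    rw [hβ.invariants_eq] at this
    exact Algebra.mem_bot.1 this
  have hinj : Function.Injective (algebraMap K R) := FaithfulSMul.algebraMap_injective K R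
  choose τ hτ using hmem
  refine ⟨⟨⟨τ, fun s t => hinj ?_⟩, fun k s => hinj ?_⟩, hτ⟩
  · simp only [_root_.map_add, hτ, ← Finset.sum_add_distrib, val_add]
  · simp only [_root_.map_mul, hτ, smul_eq_mul, RingHom.id_apply, _root_.map_smul, val_smul,
      Finset.mul_sum]
    simp only [Algebra.smul_def]

/-- In `E_a` the factor `u i` acts as its projection, so orthonormality leaves only the term `f =
proj`, which contributes `s 1_a`. -/
theorem IsCoordinateSystem.sum_trace_smul [Fintype G] (hsum : β.IsDirectSum)
    {ι : Type*} [Fintype ι] {u v : ι → S} (h : β.IsCoordinateSystem S u v)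
    {τ : S →ₗ[K] K} (hτ : ∀ s : S,
      algebraMap K R (τ s) = ∑ a, ∑ f : β.arrowHoms S a, β.val (f.1 s)) (s : S) :
    ∑ i, τ (s * v i) • u i = s := by
  classical
  refine Subtype.ext ?_
  rw [AddSubmonoidClass.coe_finsetSum]
  calc ∑ i, ((τ (s * v i) • u i : S) : R)
      = ∑ i, ∑ a, ∑ f : β.arrowHoms S a, β.val (f.1 s) * β.val (f.1 (v i)) * u i := by
        refine Finset.sum_congr rfl fun i _ => ?_
        rw [Subalgebra.coe_smul, Algebra.smul_def, hτ, Finset.sum_mul]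
        refine Finset.sum_congr rfl fun a _ => ?_
        rw [Finset.sum_mul]
        refine Finset.sum_congr rfl fun f _ => ?_
        rw [_root_.map_mul, val_mul]
    _ = ∑ a, ∑ f : β.arrowHoms S a, β.val (f.1 s) *
          β.val (∑ i, β.proj S a (u i) * f.1 (v i)) := by
        rw [Finset.sum_comm]
        refine Finset.sum_congr rfl fun a _ => ?_
        rw [Finset.sum_comm]
        refine Finset.sum_congr rfl fun f _ => ?_
        rw [val_sum, Finset.mul_sum]
        refine Finset.sum_congr rfl fun i _ => ?_
        rw [val_mul, val_proj]
        linear_combination -(u i : R) * β.val (f.1 s) * β.val_mul_one (f.1 (v i))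
    _ = ∑ a, (s : R) * β.one a := by
        refine Finset.sum_congr rfl fun a _ => ?_
        have h1 : ∀ f : β.arrowHoms S a, ∑ i, β.proj S a (u i) * f.1 (v i) =
            if f = ⟨_, β.proj_mem_arrowHoms a⟩ then 1 else 0 :=
          fun f => h.sum_arrowHoms ⟨_, β.proj_mem_arrowHoms a⟩ f
        simp only [h1]
        rw [Finset.sum_eq_single ⟨_, β.proj_mem_arrowHoms a⟩]
        · rw [if_pos rfl, val_one, val_mul_one, val_proj]
        · intro f _ hf
          rw [if_neg hf, val_zero, mul_zero]
        · simp
    _ = s := by rw [← Finset.mul_sum, hsum.sum_one, mul_one]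

end Components

end GroupoidAction

/-! ### Separability and coordinate systems. -/

/-- Separability is the existence of a separability idempotent. -/
theorem isSeparableAlgebra_iff {K A : Type*} [CommRing K] [CommRing A] [Algebra K A] :
    IsSeparableAlgebra K A ↔ ∃ e : A ⊗[K] A, Algebra.TensorProduct.lmul' K (S := A) e = 1 ∧
      ∀ a : A, (a ⊗ₜ[K] (1 : A)) * e = ((1 : A) ⊗ₜ[K] a) * e := by
  let _ : Module (A ⊗[K] A) A := (Algebra.TensorProduct.lmul' K (S := A)).toRingHom.toModule
  have hsmul : ∀ (z : A ⊗[K] A) (a : A), z • a = Algebra.TensorProduct.lmul' K (S := A) z * a :=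
    fun _ _ => rfl
  let μ : A ⊗[K] A →ₗ[A ⊗[K] A] A :=
    { toFun := Algebra.TensorProduct.lmul' K (S := A)
      map_add' := map_add _
      map_smul' := fun z w => by rw [smul_eq_mul, _root_.map_mul]; rfl }
  constructor
  · intro (h : Module.Projective (A ⊗[K] A) A)
    obtain ⟨s, hs⟩ := Module.projective_lifting_property μ LinearMap.id
      (fun a => ⟨a ⊗ₜ 1, by change Algebra.TensorProduct.lmul' K (S := A) _ = a; simp⟩)
    refine ⟨s 1, LinearMap.congr_fun hs 1, fun a => ?_⟩
    rw [← smul_eq_mul, ← smul_eq_mul, ← map_smul, ← map_smul, hsmul, hsmul]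
    simp
  · rintro ⟨e, he, hcomm⟩
    -- Every `z` acts on `e` through its product; this makes `a ↦ (a ⊗ 1) e` linear over `A ⊗ A`.
    have hz : ∀ z : A ⊗[K] A,
        (Algebra.TensorProduct.lmul' K (S := A) z ⊗ₜ[K] (1 : A)) * e = z * e := by
      intro z
      induction z with
      | zero => simp
      | add x y hx hy => rw [_root_.map_add, TensorProduct.add_tmul, add_mul, add_mul, hx, hy]
      | tmul x y =>
        have hxy : x ⊗ₜ[K] y = (x ⊗ₜ[K] (1 : A)) * ((1 : A) ⊗ₜ[K] y) := by simp
        rw [hxy, mul_assoc, ← hcomm, ← mul_assoc]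
        simp
    let s : A →ₗ[A ⊗[K] A] A ⊗[K] A :=
      { toFun := fun a => (a ⊗ₜ[K] (1 : A)) * e
        map_add' := fun a b => by rw [TensorProduct.add_tmul, add_mul]
        map_smul' := fun z a => by
          rw [hsmul, RingHom.id_apply, smul_eq_mul, ← mul_assoc, ← hz, ← hz (z * _)]
          simp }
    refine (Module.Projective.of_split s μ (LinearMap.ext fun a => ?_) :
      Module.Projective (A ⊗[K] A) A)
    change Algebra.TensorProduct.lmul' K (S := A) ((a ⊗ₜ[K] (1 : A)) * e) = a
    rw [_root_.map_mul, he]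
    simp

namespace GroupoidAction

variable {G K R : Type*} [Groupoid G] [CommRing K] [CommRing R] [Algebra K R]
variable {β : GroupoidAction G K R} {S : Subalgebra K R}

/-- The separability idempotent is `∑ u i ⊗ v i`: expand `t * u i` in the `u k`, move the scalars
across the tensor sign, and resum with the symmetric dual basis formula. -/
theorem IsCoordinateSystem.isSeparableAlgebra [Finite G] [∀ a b : G, Finite (a ⟶ b)]
    [FaithfulSMul K R] (hsum : β.IsDirectSum) (hβ : β.IsGaloisExtension)
    {ι : Type*} [Fintype ι] {u v : ι → S} (h : β.IsCoordinateSystem S u v) :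
    IsSeparableAlgebra K S := by
  have := Fintype.ofFinite G
  obtain ⟨τ, hτ⟩ := hβ.exists_trace (S := S) hsum
  refine isSeparableAlgebra_iff.2 ⟨∑ i, u i ⊗ₜ v i, ?_, fun t => ?_⟩
  · simpa using h.sum_mul hsum
  · simp only [Finset.mul_sum, Algebra.TensorProduct.tmul_mul_tmul, _root_.one_mul]
    calc ∑ i, (t * u i) ⊗ₜ[K] v i
        = ∑ i, (∑ k, τ (t * u i * v k) • u k) ⊗ₜ[K] v i := by
          simp only [h.sum_trace_smul hsum hτ]
      _ = ∑ k, u k ⊗ₜ[K] (∑ i, τ (t * v k * u i) • v i) := by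
          simp only [TensorProduct.sum_tmul, TensorProduct.tmul_sum, TensorProduct.smul_tmul]
          rw [Finset.sum_comm]
          simp only [mul_right_comm]
      _ = ∑ k, u k ⊗ₜ[K] (t * v k) := by
          simp only [h.symm.sum_trace_smul hsum hτ]

/-- The homomorphism `s ⊗ t ↦ β_g(s 1_{g⁻¹}) β_h(t 1_{h⁻¹})`. -/
noncomputable def appTensor (S : Subalgebra K R) (β : GroupoidAction G K R) {a b c : G}
    (g : a ⟶ c) (h : b ⟶ c) : S ⊗[K] S →ₐ[K] β.Piece c :=
  Algebra.TensorProduct.lift (β.push g (β.proj S a)) (β.push h (β.proj S b))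
    (fun _ _ => Commute.all _ _)

theorem val_appTensor_tmul {a b c : G} (g : a ⟶ c) (h : b ⟶ c) (s t : S) :
    β.val (appTensor S β g h (s ⊗ₜ t)) = β.app g s * β.app h t := by
  rw [appTensor, Algebra.TensorProduct.lift_tmul, val_mul, val_push_proj, val_push_proj]

/-- For `g ∉ H_S` the coordinate sum is the image `π` of the idempotent `e` under `s ⊗ t ↦ s
β_g(t)`. Since `(t ⊗ 1) e = (1 ⊗ t) e`, one gets `t π = β_g(t) π` for all `t ∈ S`, and strongness
forces `π = 0`. The index type is a finset of pairs from `S`, whence the universe of `R`. -/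
theorem exists_isCoordinateSystem_of_isSeparableAlgebra {G K : Type*} {R : Type w} [Groupoid G]
    [CommRing K] [CommRing R] [Algebra K R] {β : GroupoidAction G K R} {S : Subalgebra K R}
    (hsep : IsSeparableAlgebra K S)
    (hstrong : β.IsStrong S) :
    ∃ (ι : Type w) (_ : Fintype ι) (u v : ι → S), β.IsCoordinateSystem S u v := by
  classical
  obtain ⟨e, he, hcomm⟩ := isSeparableAlgebra_iff.1 hsep
  obtain ⟨s, hs⟩ := TensorProduct.exists_finset e
  have hee : IsIdempotentElem e := by
    have hz : ∀ z : S ⊗[K] S,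
        z * e = (Algebra.TensorProduct.lmul' K (S := S) z ⊗ₜ[K] (1 : S)) * e := by
      intro z
      induction z with
      | zero => simp
      | add x y hx hy => rw [_root_.map_add, TensorProduct.add_tmul, add_mul, add_mul, hx, hy]
      | tmul x y =>
        have hxy : x ⊗ₜ[K] y = (x ⊗ₜ[K] (1 : S)) * ((1 : S) ⊗ₜ[K] y) := by simp
        rw [hxy, mul_assoc, ← hcomm, ← mul_assoc]
        simp
    have := hz e
    rwa [he, ← Algebra.TensorProduct.one_def, _root_.one_mul] at this
  refine ⟨s, inferInstance, fun i => i.1.1, fun i => i.1.2, fun a b g => ?_⟩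
  by_cases hg : g ∈ (β.fixing S).arrows a b
  · rw [if_pos hg]
    have h1 : ∑ i : s, i.1.1 * i.1.2 = 1 := by
      rw [← he, hs, map_sum, ← Finset.sum_coe_sort s]
      simp
    calc ∑ i : s, (i.1.1 : R) * β.app g (i.1.2 : R)
        = (∑ i : s, (i.1.1 : R) * (i.1.2 : R)) * β.one b := by
          rw [Finset.sum_mul]
          refine Finset.sum_congr rfl fun i _ => ?_
          rw [hg _ i.1.2.2, mul_assoc]
      _ = ((∑ i : s, i.1.1 * i.1.2 : S) : R) * β.one b := by
          rw [AddSubmonoidClass.coe_finsetSum]; rfl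
      _ = β.one b := by rw [h1]; exact _root_.one_mul _
  · rw [if_neg hg]
    have hπ : ∑ i : s, (i.1.1 : R) * β.app g (i.1.2 : R) =
        β.val (appTensor S β (𝟙 b) g e) := by
      rw [hs, map_sum, val_sum, ← Finset.sum_coe_sort s]
      refine Finset.sum_congr rfl fun i _ => ?_
      rw [val_appTensor_tmul, app_id, mul_assoc, one_mul_app]
    rw [hπ]
    by_contra hne
    obtain ⟨t, ht, hneq⟩ := hstrong b a b (𝟙 b) g
      (by
        rw [comp_inv_mem_fixing_iff]
        exact fun hh => hg fun t ht => by simpa only [app_id] using hh t ht)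
      _ (β.val_mem _)
      (by
        change _ * _ = _
        rw [← val_mul, ← _root_.map_mul, hee.eq]) hne
    refine hneq ?_
    have := congrArg (fun z => β.val (appTensor S β (𝟙 b) g z)) (hcomm ⟨t, ht⟩)
    simp only [_root_.map_mul, val_mul, val_appTensor_tmul, OneMemClass.coe_one, app_unit] at this
    rw [β.app_mul_one_target, β.one_mul_app] at this
    exact this

/-- The same families are coordinates for the larger algebra `R^{β_{H_S}}`, whose dual basis formula
writes its elements as `K`-combinations of the `u i ∈ S`. -/
theorem IsCoordinateSystem.eq_invariants [Finite G] [∀ a b : G, Finite (a ⟶ b)]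
    [FaithfulSMul K R] (hsum : β.IsDirectSum) (hβ : β.IsGaloisExtension)
    {ι : Type*} [Fintype ι] {u v : ι → S} (h : β.IsCoordinateSystem S u v) :
    S = β.invariants (β.fixing S) := by
  have := Fintype.ofFinite G
  refine le_antisymm (β.le_invariants_fixing S) fun r hr => ?_
  have hle := β.le_invariants_fixing S
  have h' : β.IsCoordinateSystem (β.invariants (β.fixing S))
      (fun i => Subalgebra.inclusion hle (u i)) (fun i => Subalgebra.inclusion hle (v i)) := by
    intro a b g
    rw [fixing_invariants_fixing]
    exact h a b g
  obtain ⟨τ, hτ⟩ := hβ.exists_trace (S := β.invariants (β.fixing S)) hsum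
  have h1 := congrArg Subtype.val (h'.sum_trace_smul hsum hτ ⟨r, hr⟩)
  rw [AddSubmonoidClass.coe_finsetSum] at h1
  change _ = r at h1
  rw [← h1]
  exact Subalgebra.sum_mem _ fun i _ => S.smul_mem (u i).2 _

end GroupoidAction

namespace GroupoidAction

variable {G K R : Type*} [Groupoid G] [CommRing K] [CommRing R] [Algebra K R]
variable {β : GroupoidAction G K R}

/-! ### Traces of subgroupoids and coordinates for their invariants. -/

section Trace

variable (β) [Fintype G] [∀ a b : G, Finite (a ⟶ b)]

noncomputable instance (b : G) : Fintype (Σ a : G, (a ⟶ b)) := Fintype.ofFinite _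

open scoped Classical in
/-- The trace `r ↦ ∑_{h ∈ H} β_h(r 1_{h⁻¹})` of the action of a subgroupoid `H`. -/
noncomputable def trace (H : Subgroupoid G) (r : R) : R :=
  ∑ b, ∑ p : Σ a : G, (a ⟶ b), if p.2 ∈ H.arrows p.1 b then β.app p.2 r else 0

theorem trace_add (H : Subgroupoid G) (r s : R) :
    β.trace H (r + s) = β.trace H r + β.trace H s := by
  classical
  simp only [trace, ← Finset.sum_add_distrib]
  refine Finset.sum_congr rfl fun b _ => Finset.sum_congr rfl fun p _ => ?_
  split_ifs
  · exact β.app_add _ _ _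
  · rw [add_zero]

variable {β}

theorem trace_mul {H : Subgroupoid G} {s : R} (hs : s ∈ β.invariants H) (r : R) :
    β.trace H (s * r) = s * β.trace H r := by
  classical
  simp only [trace, Finset.mul_sum]
  refine Finset.sum_congr rfl fun b _ => Finset.sum_congr rfl fun p _ => ?_
  split_ifs with hp
  · rw [app_mul, β.mem_invariants_iff.1 hs _ _ _ hp, mul_assoc, one_mul_app]
  · rw [mul_zero]

open scoped Classical in
theorem IsDirectSum.trace_mul_one (hsum : β.IsDirectSum) (H : Subgroupoid G) (b : G) (r : R) :
    β.trace H r * β.one b =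
      ∑ p : Σ a : G, (a ⟶ b), if p.2 ∈ H.arrows p.1 b then β.app p.2 r else 0 := by
  rw [trace, Finset.sum_mul, Finset.sum_eq_single b]
  · rw [Finset.sum_mul]
    refine Finset.sum_congr rfl fun p _ => ?_
    split_ifs
    · rw [app_mul_one_target]
    · rw [zero_mul]
  · intro c _ hc
    rw [Finset.sum_mul]
    refine Finset.sum_eq_zero fun p _ => ?_
    split_ifs
    · exact hsum.mul_eq_zero hc (β.app_mem _ _) (β.one_mem b)
    · rw [zero_mul]
  · simp

open scoped Classical in
theorem IsDirectSum.app_trace (hsum : β.IsDirectSum) (H : Subgroupoid G) {a b : G} (g : a ⟶ b)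
    (r : R) : β.app g (β.trace H r) =
      ∑ p : Σ c : G, (c ⟶ a), if p.2 ∈ H.arrows p.1 a then β.app (p.2 ≫ g) r else 0 := by
  rw [← app_mul_one, hsum.trace_mul_one, app_sum]
  refine Finset.sum_congr rfl fun p _ => ?_
  split_ifs
  · rw [app_comp]
  · rw [app_zero]

/-- Composition with `g ∈ H` permutes the summands: it maps the arrows of `H` into `a` bijectively
to those into `b`. -/
theorem IsDirectSum.trace_mem (hsum : β.IsDirectSum) (H : Subgroupoid G) (r : R) :
    β.trace H r ∈ β.invariants H := by
  classical
  refine β.mem_invariants_iff.2 fun a b g hg => ?_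
  rw [hsum.trace_mul_one, hsum.app_trace]
  refine Fintype.sum_bijective (fun p : Σ c : G, (c ⟶ a) => (⟨p.1, p.2 ≫ g⟩ : Σ c : G, (c ⟶ b)))
    ⟨?_, ?_⟩ _ _ fun p => ?_
  · rintro ⟨c, h⟩ ⟨d, k⟩ e
    obtain ⟨rfl, e⟩ := Sigma.mk.inj_iff.1 e
    exact congrArg (Sigma.mk c) ((cancel_mono g).1 (eq_of_heq e))
  · rintro ⟨c, h⟩
    exact ⟨⟨c, h ≫ Groupoid.inv g⟩, by simp⟩
  · have : p.2 ∈ H.arrows p.1 a ↔ p.2 ≫ g ∈ H.arrows p.1 b := by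
      refine ⟨fun h => H.mul h hg, fun h => ?_⟩
      simpa using H.mul h (H.inv hg)
    simp only [this]

end Trace

-- Comparison in the sigma type merges the three cases, since arrows with different sources cannot
-- be equated directly.
open scoped Classical in
theorem IsGaloisExtension.exists_coordinates_ite (hβ : β.IsGaloisExtension) :
    ∃ (n : ℕ) (x y : Fin n → R), ∀ (a b : G) (g : a ⟶ b), ∑ i, x i * β.app g (y i) =
      if (⟨a, g⟩ : Σ c : G, (c ⟶ b)) = ⟨b, 𝟙 b⟩ then β.one b else 0 := by
  obtain ⟨n, x, y, h1, h2, h3⟩ := hβ.exists_coordinates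
  refine ⟨n, x, y, fun a b g => ?_⟩
  by_cases hab : a = b
  · subst hab
    by_cases hg : g = 𝟙 a
    · rw [hg, h1, if_pos rfl]
    · rw [h2 a g hg, if_neg]
      intro e
      exact hg (eq_of_heq (Sigma.mk.inj_iff.1 e).2)
  · rw [h3 a b g hab, if_neg]
    intro e
    exact hab (Sigma.mk.inj_iff.1 e).1

variable [Fintype G] [∀ a b : G, Finite (a ⟶ b)]

open scoped Classical in
theorem IsDirectSum.sum_mul_trace (hsum : β.IsDirectSum) {H : Subgroupoid G} (hH : H.IsWide)
    {ι : Type*} [Fintype ι] {x y : ι → R}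
    (hxy : ∀ (a b : G) (g : a ⟶ b), ∑ i, x i * β.app g (y i) =
      if (⟨a, g⟩ : Σ c : G, (c ⟶ b)) = ⟨b, 𝟙 b⟩ then β.one b else 0) (r : R) :
    ∑ i, x i * β.trace H (y i * r) = r := by
  have hb : ∀ b, (∑ i, x i * β.trace H (y i * r)) * β.one b = r * β.one b := by
    intro b
    calc (∑ i, x i * β.trace H (y i * r)) * β.one b
        = ∑ i, ∑ p : Σ a : G, (a ⟶ b), if p.2 ∈ H.arrows p.1 b then
            x i * β.app p.2 (y i) * β.app p.2 r else 0 := by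
          rw [Finset.sum_mul]
          refine Finset.sum_congr rfl fun i _ => ?_
          rw [mul_assoc, hsum.trace_mul_one, Finset.mul_sum]
          refine Finset.sum_congr rfl fun p _ => ?_
          rw [app_mul, mul_ite, mul_zero, mul_assoc]
      _ = ∑ p : Σ a : G, (a ⟶ b), if p.2 ∈ H.arrows p.1 b then
            (∑ i, x i * β.app p.2 (y i)) * β.app p.2 r else 0 := by
          rw [Finset.sum_comm]
          refine Finset.sum_congr rfl fun p _ => ?_
          split_ifs
          · rw [Finset.sum_mul]
          · rw [Finset.sum_const_zero]
      _ = r * β.one b := by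
          rw [Finset.sum_eq_single ⟨b, 𝟙 b⟩]
          · rw [if_pos (hH.wide b), hxy, if_pos rfl, one_mul_app, app_id]
          · intro p _ hp
            rw [hxy, if_neg hp, zero_mul, ite_self]
          · simp
  calc ∑ i, x i * β.trace H (y i * r)
      = ∑ b, (∑ i, x i * β.trace H (y i * r)) * β.one b := by
        rw [← Finset.mul_sum, hsum.sum_one, mul_one]
    _ = r := by simp only [hb, ← Finset.mul_sum, hsum.sum_one, mul_one]

/-- The image `I` of `tr_H` is an ideal of `R^{β_H}`. By `sum_mul_trace` the `x i` generate `R` over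
`R^{β_H}` with coefficients in `I`, so `R = I R`, and Nakayama gives `s ∈ 1 + I` killing `R`. Then
`s = 0` and `1 ∈ I`. -/
theorem IsGaloisExtension.exists_trace_eq_one (hsum : β.IsDirectSum) (hβ : β.IsGaloisExtension)
    {H : Subgroupoid G} (hH : H.IsWide) : ∃ c, β.trace H c = 1 := by
  classical
  obtain ⟨n, x, y, hxy⟩ := hβ.exists_coordinates_ite
  let tr : R →ₗ[β.invariants H] β.invariants H :=
    { toFun := fun r => ⟨β.trace H r, hsum.trace_mem H r⟩
      map_add' := fun r s => Subtype.ext (β.trace_add H r s)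
      map_smul' := fun s r => Subtype.ext (trace_mul s.2 r) }
  let I : Ideal (β.invariants H) := LinearMap.range tr
  have hsumr : ∀ r : R, r = ∑ i, tr (y i * r) • x i := by
    intro r
    conv_lhs => rw [← hsum.sum_mul_trace hH hxy r]
    exact Finset.sum_congr rfl fun i _ => mul_comm _ _
  obtain ⟨s, hs1, hs2⟩ := Submodule.exists_sub_one_mem_and_smul_eq_zero_of_fg_of_le_smul I
    (⊤ : Submodule (β.invariants H) R)
    ⟨Finset.univ.image x, by
      refine eq_top_iff.2 fun r _ => ?_
      rw [hsumr r]
      exact Submodule.sum_mem _ fun i _ =>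
        Submodule.smul_mem _ _ (Submodule.subset_span (by simp))⟩
    (fun r _ => by
      rw [hsumr r]
      exact Submodule.sum_mem _ fun i _ =>
        Submodule.smul_mem_smul (LinearMap.mem_range_self tr _) Submodule.mem_top)
  have hs : s = 0 := Subtype.ext ((mul_one (s : R)).symm.trans (hs2 1 Submodule.mem_top))
  rw [hs, zero_sub, Ideal.neg_mem_iff] at hs1
  obtain ⟨c, hc⟩ := hs1
  exact ⟨c, congrArg Subtype.val hc⟩

open scoped Classical in
theorem IsGaloisExtension.exists_invariant_coordinates (hsum : β.IsDirectSum)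
    (hβ : β.IsGaloisExtension) {H : Subgroupoid G} (hH : H.IsWide) :
    ∃ (n : ℕ) (u v : Fin n → β.invariants H), ∀ (a b : G) (g : a ⟶ b),
      ∑ i, (u i : R) * β.app g (v i) = if g ∈ H.arrows a b then β.one b else 0 := by
  obtain ⟨c, hc⟩ := hβ.exists_trace_eq_one hsum hH
  obtain ⟨n, x, y, hxy⟩ := hβ.exists_coordinates_ite
  refine ⟨n, fun i => ⟨β.trace H (c * x i), hsum.trace_mem H _⟩,
    fun i => ⟨β.trace H (y i), hsum.trace_mem H _⟩, fun a b g => ?_⟩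
  -- Apply `β_p` to the Galois relation at `p⁻¹gq`, which is an identity exactly when `p = gq`.
  have hterm : ∀ (p : Σ d : G, (d ⟶ b)) (q : Σ d : G, (d ⟶ a)),
      ∑ i, β.app p.2 (c * x i) * β.app (q.2 ≫ g) (y i) =
        if p = ⟨q.1, q.2 ≫ g⟩ then β.app p.2 c else 0 := by
    rintro ⟨d, p⟩ ⟨e, q⟩
    calc ∑ i, β.app p (c * x i) * β.app (q ≫ g) (y i)
        = β.app p c * β.app p (∑ i, x i * β.app ((q ≫ g) ≫ Groupoid.inv p) (y i)) := by
          rw [app_sum, Finset.mul_sum]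
          refine Finset.sum_congr rfl fun i _ => ?_
          rw [app_mul, app_mul, app_comp β (q ≫ g), app_app_inv, app_mul_one_target, mul_assoc]
      _ = _ := by
          rw [hxy]
          have hiff : (⟨e, (q ≫ g) ≫ Groupoid.inv p⟩ : Σ c : G, (c ⟶ d)) = ⟨d, 𝟙 d⟩ ↔
              (⟨d, p⟩ : Σ d : G, (d ⟶ b)) = ⟨e, q ≫ g⟩ := by
            constructor
            · intro h
              obtain ⟨rfl, h⟩ := Sigma.mk.inj_iff.1 h
              have h := congrArg (· ≫ p) (eq_of_heq h)
              simp only [Category.assoc, Groupoid.inv_comp, Category.comp_id,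
                Category.id_comp] at h
              rw [h]
            · intro h
              obtain ⟨rfl, h⟩ := Sigma.mk.inj_iff.1 h
              rw [← eq_of_heq h, Groupoid.comp_inv]
          by_cases h : (⟨d, p⟩ : Σ d : G, (d ⟶ b)) = ⟨e, q ≫ g⟩
          · rw [if_pos h, if_pos (hiff.2 h), app_one, app_mul_one_target]
          · rw [if_neg h, if_neg (mt hiff.1 h), app_zero, mul_zero]
  calc ∑ i, β.trace H (c * x i) * β.app g (β.trace H (y i))
      = ∑ i, (β.trace H (c * x i) * β.one b) * β.app g (β.trace H (y i)) := by
        refine Finset.sum_congr rfl fun i _ => ?_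
        rw [mul_assoc, one_mul_app]
    _ = ∑ p : Σ d : G, (d ⟶ b), ∑ q : Σ d : G, (d ⟶ a),
          if p.2 ∈ H.arrows p.1 b then if q.2 ∈ H.arrows q.1 a then
            ∑ i, β.app p.2 (c * x i) * β.app (q.2 ≫ g) (y i) else 0 else 0 := by
        simp only [hsum.trace_mul_one, hsum.app_trace, Finset.sum_mul_sum]
        rw [Finset.sum_comm]
        refine Finset.sum_congr rfl fun p _ => ?_
        rw [Finset.sum_comm]
        refine Finset.sum_congr rfl fun q _ => ?_
        split_ifs <;> simp
    _ = ∑ p : Σ d : G, (d ⟶ b), if g ∈ H.arrows a b then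
          if p.2 ∈ H.arrows p.1 b then β.app p.2 c else 0 else 0 := by
        refine Finset.sum_congr rfl fun p _ => ?_
        simp only [hterm]
        -- For given `p ∈ H` only `q = g⁻¹p` survives, and it lies in `H` iff `g` does; what remains
        -- is `tr_H(c) 1_b = 1_b`.
        rw [Finset.sum_eq_single ⟨p.1, p.2 ≫ Groupoid.inv g⟩]
        · have hp : p = ⟨p.1, (p.2 ≫ Groupoid.inv g) ≫ g⟩ := by simp
          rw [if_pos hp]
          by_cases h1 : p.2 ∈ H.arrows p.1 b
          · have hiff : p.2 ≫ Groupoid.inv g ∈ H.arrows p.1 a ↔ g ∈ H.arrows a b := by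
              constructor
              · intro h2
                simpa using H.inv (H.mul (H.inv h1) h2)
              · intro h2
                exact H.mul h1 (H.inv h2)
            simp only [hiff, if_pos h1]
          · simp only [if_neg h1, ite_self]
        · intro q _ hq
          have hpq : p ≠ ⟨q.1, q.2 ≫ g⟩ := by
            rintro rfl
            exact hq (by simp)
          simp only [if_neg hpq, ite_self]
        · simp
    _ = if g ∈ H.arrows a b then β.one b else 0 := by
        split_ifs
        · rw [← hsum.trace_mul_one, hc, _root_.one_mul]
        · exact Finset.sum_const_zero

end GroupoidAction

/-! ### Splitting of `E_e ⊗ S` and equality of ranks. -/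

namespace GroupoidAction

variable {G K R : Type*} [Groupoid G] [CommRing K] [CommRing R] [Algebra K R]
variable {β : GroupoidAction G K R} {S : Subalgebra K R}

/-- The homomorphism `E_e ⊗ S → (E_e)^n` of `E_e`-algebras with given components. -/
noncomputable def splitHom {B : Type*} [CommRing B] [Algebra K B] {a : G} {n : ℕ}
    (f : Fin n → (B →ₐ[K] β.Piece a)) : β.Piece a ⊗[K] B →ₐ[β.Piece a] (Fin n → β.Piece a) :=
  AlgHom.pi fun i => Algebra.TensorProduct.lift (Algebra.ofId _ _) (f i)
    (fun _ _ => Commute.all _ _)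

theorem splitHom_tmul {B : Type*} [CommRing B] [Algebra K B] {a : G} {n : ℕ}
    (f : Fin n → (B →ₐ[K] β.Piece a)) (z : β.Piece a) (b : B) (i : Fin n) :
    splitHom f (z ⊗ₜ b) i = z * f i b := by
  simp [splitHom]

theorem IsCoordinateSystem.splitHom_surjective {ι : Type*} [Fintype ι] {u v : ι → S}
    (h : β.IsCoordinateSystem S u v) {a : G} {n : ℕ} (σ : Fin n ≃ β.arrowHoms S a) :
    Function.Surjective (splitHom fun i => (σ i).1) := by
  classical
  intro c
  refine ⟨∑ j, ∑ i, (c j * (σ j).1 (u i)) ⊗ₜ v i, funext fun k => ?_⟩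
  simp only [map_sum, Finset.sum_apply, splitHom_tmul, mul_assoc]
  simp only [← Finset.mul_sum, h.sum_arrowHoms, EmbeddingLike.apply_eq_iff_eq]
  simp

/-- Over the zero ring all homomorphisms coincide, so rank `1` works and every set of components is
the same singleton. -/
theorem isUniformlySplit_of_subsingleton [Subsingleton R] (B : Type*) [CommRing B]
    [Algebra K B] : β.IsUniformlySplit B := by
  have hp : ∀ a, Subsingleton (β.Piece a) := fun a =>
    (β.val_injective a).subsingleton
  have ht : ∀ a, Subsingleton (β.Piece a ⊗[K] B) := fun a => by
    have : (1 : β.Piece a ⊗[K] B) = 0 := by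
      rw [Algebra.TensorProduct.one_def, Subsingleton.elim (1 : β.Piece a) 0,
        TensorProduct.zero_tmul]
    exact subsingleton_of_zero_eq_one this.symm
  have hs : ∀ a, Subsingleton (B →ₐ[K] β.Piece a) := fun a =>
    ⟨fun f f' => AlgHom.ext fun _ => Subsingleton.elim _ _⟩
  let f : ∀ a : G, B →ₐ[K] β.Piece a := fun a =>
    { toFun := fun _ => 0
      map_one' := Subsingleton.elim _ _
      map_mul' := fun _ _ => Subsingleton.elim _ _
      map_zero' := rfl
      map_add' := fun _ _ => Subsingleton.elim _ _
      commutes' := fun _ => Subsingleton.elim _ _ }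
  refine ⟨1, le_rfl, fun _ => le_rfl, fun a => AlgEquiv.ofBijective (splitHom fun _ => f a)
    ⟨fun _ _ _ => Subsingleton.elim _ _, fun _ => ⟨0, Subsingleton.elim _ _⟩⟩, fun a b g => ?_⟩
  have hall : ∀ c (φ : (β.Piece c ⊗[K] B) ≃ₐ[β.Piece c] (Fin 1 → β.Piece c)),
      β.components φ = {f c} := by
    intro c φ
    refine Set.eq_singleton_iff_unique_mem.2 ⟨⟨0, fun _ => Subsingleton.elim _ _⟩, fun _ _ =>
      Subsingleton.elim _ _⟩
  rw [hall, hall]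
  exact Set.bijOn_singleton.2 (Subsingleton.elim _ _)

/-- The sum `ε` of the identities `1_c` over the connected component of `a` is invariant, hence a
scalar. If `b` lay outside, it would kill the faithful module `E_b`, so `ε = 0` and `1_a = 0`,
against faithfulness of `E_a`. -/
theorem IsGaloisExtension.nonempty_hom [Finite G] [Nontrivial K] (hsum : β.IsDirectSum)
    (hβ : β.IsGaloisExtension) (hfaith : ∀ a : G, FaithfulSMul K (β.Piece a)) (a b : G) :
    Nonempty (a ⟶ b) := by
  classical
  have := Fintype.ofFinite G
  by_contra hab
  let ε : R := ∑ c, if Nonempty (a ⟶ c) then β.one c else 0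
  have hone : ∀ c, ε * β.one c = if Nonempty (a ⟶ c) then β.one c else 0 := by
    intro c
    rw [Finset.sum_mul, Finset.sum_eq_single c]
    · rw [ite_mul, zero_mul, one_mul_one]
    · intro d _ hd
      rw [ite_mul, zero_mul, hsum.one_mul_one_of_ne hd, ite_self]
    · simp
  have hmem : ε ∈ β.invariants ⊤ := by
    refine β.mem_invariants_iff.2 fun c d g _ => ?_
    have hiff : Nonempty (a ⟶ c) ↔ Nonempty (a ⟶ d) :=
      ⟨fun ⟨k⟩ => ⟨k ≫ g⟩, fun ⟨k⟩ => ⟨k ≫ Groupoid.inv g⟩⟩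
    rw [← app_mul_one, hone, hone]
    by_cases hc : Nonempty (a ⟶ c)
    · rw [if_pos hc, if_pos (hiff.1 hc), app_one]
    · rw [if_neg hc, if_neg (mt hiff.2 hc), app_zero]
  rw [hβ.invariants_eq] at hmem
  obtain ⟨k, hk⟩ := Algebra.mem_bot.1 hmem
  have hk0 : k = 0 := by
    refine (hfaith b).eq_of_smul_eq_smul fun x => β.val_injective b ?_
    rw [zero_smul, val_zero, val_smul, Algebra.smul_def, hk, ← one_mul_val, ← mul_assoc, hone,
      if_neg hab, zero_mul]
  have h10 : (1 : K) = 0 := by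
    refine (hfaith a).eq_of_smul_eq_smul fun x => β.val_injective a ?_
    have : β.one a = 0 := by
      have h := hone a
      rwa [if_pos ⟨𝟙 a⟩, ← hk, hk0, _root_.map_zero, zero_mul, eq_comm] at h
    rw [one_smul, zero_smul, val_zero, ← one_mul_val, this, zero_mul]
  exact one_ne_zero h10

variable [Finite G] [∀ a b : G, Finite (a ⟶ b)]

theorem IsCoordinateSystem.splitHom_injective [FaithfulSMul K R] (hsum : β.IsDirectSum)
    (hβ : β.IsGaloisExtension) {ι : Type*} [Fintype ι] {u v : ι → S}
    (h : β.IsCoordinateSystem S u v) {a : G} {n : ℕ} (σ : Fin n ≃ β.arrowHoms S a) :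
    Function.Injective (splitHom fun i => (σ i).1) := by
  have := Fintype.ofFinite G
  obtain ⟨τ, hτ⟩ := hβ.exists_trace (S := S) hsum
  have hτa : ∀ (z : β.Piece a) (s : S), τ s • z = ∑ j, z * (σ j).1 s := by
    intro z s
    refine β.val_injective a ?_
    rw [val_smul, Algebra.smul_def, hτ, Finset.sum_mul, Finset.sum_eq_single a, Finset.sum_mul,
      val_sum]
    · refine (Fintype.sum_equiv σ _ _ fun j => ?_).symm
      rw [val_mul, mul_comm]
    · intro b _ hb
      rw [Finset.sum_mul]
      exact Finset.sum_eq_zero fun f _ => hsum.mul_eq_zero hb (β.val_mem _) (β.val_mem _)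
    · simp
  -- An explicit left inverse. On pure tensors it is the dual basis formula, because `τ s` acts on
  -- `E_a` as `∑ j, σ j s`.
  have key : ∀ w : β.Piece a ⊗[K] S, w =
      ∑ i, (∑ j, splitHom (fun i => (σ i).1) w j * (σ j).1 (v i)) ⊗ₜ[K] u i := by
    intro w
    induction w with
    | zero => simp
    | add x y hx hy =>
      conv_lhs => rw [hx, hy]
      simp only [_root_.map_add, Pi.add_apply, add_mul, Finset.sum_add_distrib,
        TensorProduct.add_tmul]
    | tmul z s =>
      conv_lhs => rw [← h.sum_trace_smul hsum hτ s, TensorProduct.tmul_sum]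
      refine Finset.sum_congr rfl fun i _ => ?_
      rw [← TensorProduct.smul_tmul, hτa]
      simp only [splitHom_tmul, _root_.map_mul, mul_assoc]
  refine (injective_iff_map_eq_zero _).2 fun w hw => ?_
  rw [key w, hw]
  simp

theorem IsCoordinateSystem.isSplitWith [FaithfulSMul K R] (hsum : β.IsDirectSum)
    (hβ : β.IsGaloisExtension) {ι : Type*} [Fintype ι] {u v : ι → S}
    (h : β.IsCoordinateSystem S u v) {n : G → ℕ} (hn : ∀ a, Nat.card (β.arrowHoms S a) = n a) :
    β.IsSplitWith S n := by
  have σ : ∀ a, Fin (n a) ≃ β.arrowHoms S a := fun a => (Finite.equivFinOfCardEq (hn a)).symm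
  refine ⟨fun a => ?_, fun a => AlgEquiv.ofBijective (splitHom fun i => (σ a i).1)
    ⟨h.splitHom_injective hsum hβ _, h.splitHom_surjective _⟩, ?_⟩
  · rw [← hn a]
    have : Nonempty (β.arrowHoms S a) := ⟨⟨_, β.proj_mem_arrowHoms a⟩⟩
    exact Nat.card_pos
  · have hcomp : ∀ a, β.components (AlgEquiv.ofBijective (splitHom fun i => (σ a i).1)
        ⟨h.splitHom_injective hsum hβ _, h.splitHom_surjective _⟩) = β.arrowHoms S a := by
      intro a
      ext f
      have hiff : ∀ i, (∀ b : S, f b = AlgEquiv.ofBijective (splitHom fun i => (σ a i).1)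
          ⟨h.splitHom_injective hsum hβ _, h.splitHom_surjective _⟩ (1 ⊗ₜ[K] b) i) ↔
          f = (σ a i).1 := by
        intro i
        rw [DFunLike.ext_iff]
        refine forall_congr' fun b => ?_
        change f b = splitHom (fun i => (σ a i).1) (1 ⊗ₜ[K] b) i ↔ _
        rw [splitHom_tmul, _root_.one_mul]
      refine (exists_congr hiff).trans ?_
      constructor
      · rintro ⟨i, hi⟩
        rw [hi]
        exact (σ a i).2
      · intro hf
        refine ⟨(σ a).symm ⟨f, hf⟩, ?_⟩
        rw [Equiv.apply_symm_apply]
    intro a b g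
    rw [hcomp, hcomp]
    exact β.push_bijOn_arrowHoms g

/-- For nonzero `K` the groupoid is connected, and pushing along an arrow `b ⟶ a` identifies `V_b`
with `V_a`. -/
theorem IsCoordinateSystem.isUniformlySplit [FaithfulSMul K R] (hsum : β.IsDirectSum)
    (hβ : β.IsGaloisExtension) {ι : Type*} [Fintype ι] {u v : ι → S}
    (h : β.IsCoordinateSystem S u v) (hfaith : ∀ a : G, FaithfulSMul K (β.Piece a)) :
    β.IsUniformlySplit S := by
  rcases subsingleton_or_nontrivial K with hK | hK
  · have : Subsingleton R := Module.subsingleton K R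
    exact isUniformlySplit_of_subsingleton S
  · rcases isEmpty_or_nonempty G with hG | ⟨⟨a⟩⟩
    · exact ⟨1, le_rfl, h.isSplitWith hsum hβ fun a => isEmptyElim a⟩
    · have hs := h.isSplitWith hsum hβ (n := fun _ => Nat.card (β.arrowHoms S a)) fun b => by
        obtain ⟨g⟩ := hβ.nonempty_hom hsum hfaith b a
        exact Nat.card_congr (β.push_bijOn_arrowHoms g).equiv
      exact ⟨_, hs.1 a, hs⟩

end GroupoidAction

theorem lemma5p4 {G K R : Type*} [Groupoid G] [Finite G] [∀ a b : G, Finite (a ⟶ b)]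
    [CommRing K] [CommRing R] [Algebra K R] [FaithfulSMul K R]
    (β : GroupoidAction G K R) (hsum : β.IsDirectSum) (hβ : β.IsGaloisExtension)
    (T : Subalgebra K R) :
    ((IsSeparableAlgebra K T ∧ β.IsStrong T) ↔ T = β.invariants (β.fixing T)) ∧
    (T = β.invariants (β.fixing T) →
      β.IsSplit T ∧ ((∀ a : G, FaithfulSMul K (β.Piece a)) → β.IsUniformlySplit T)) := by
  have hcoord : T = β.invariants (β.fixing T) →
      ∃ (n : ℕ) (u v : Fin n → T), β.IsCoordinateSystem T u v := by
    intro hT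
    have := Fintype.ofFinite G
    obtain ⟨n, u, v, huv⟩ := hβ.exists_invariant_coordinates hsum (β.fixing_isWide T)
    exact ⟨n, fun i => ⟨u i, hT.ge (u i).2⟩, fun i => ⟨v i, hT.ge (v i).2⟩, huv⟩
  refine ⟨⟨fun ⟨hsep, hstrong⟩ => ?_, fun hT => ?_⟩, fun hT => ?_⟩
  · obtain ⟨ι, _, u, v, h⟩ :=
      GroupoidAction.exists_isCoordinateSystem_of_isSeparableAlgebra hsep hstrong
    exact h.eq_invariants hsum hβ
  · obtain ⟨n, u, v, h⟩ := hcoord hT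
    exact ⟨h.isSeparableAlgebra hsum hβ, h.isStrong⟩
  · obtain ⟨n, u, v, h⟩ := hcoord hT
    exact ⟨⟨_, h.isSplitWith hsum hβ fun a => rfl⟩, h.isUniformlySplit hsum hβ⟩
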